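/- Let $U\subseteq\mathbb{R}^n$ be open and let $\lambda^1,\dots,\lambda^n$ be smooth ($C^\infty$) real functions on $U$ such that the diagonal system $u^i_t=\lambda^i(u)\,u^i_x$ ($i=1,\dots,n$, no summation) is strictly hyperbolic, i.e. $\lambda^i(u)\neq\lambda^j(u)$ for all $u\in U$ and $i\ne j$. Put $\partial_j=\partial/\partial u^j$ and $$a_{ij}=\frac{\partial_j\lambda^i}{\lambda^j-\lambda^i}\qquad(i\neq j).$$ Prolong the system to second derivatives: on the space with coordinates $x,t,u^i,u^i_x,u^i_{xx}$, $u\in U$, consider the exterior system generated by the $2n$ one-forms $$\sigma_i=u^i_x(dx+\lambda^i dt)-du^i,\qquad \sigma_i'=u^i_{xx}\,dx+D_x(\lambda^iu^i_x)\,dt-du^i_x ,\qquad D_x(\lambda^iu^i_x)=u^i_x\sum_k u^k_x\,\partial_k\lambda^i+\lambda^iu^i_{xx},$$ and let $\mathcal V$ be its annihilator, i.e. the distribution on which all these forms vanish. An involution is a subspace of $\mathcal V$ (at a point) on which all the two-forms $d\sigma_i,d\sigma_i'$ vanish. A smooth subdistribution $\mathcal M\subseteq\mathcal V$ is a Monge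 characteristic distribution if (1) for every $m\in\mathcal M$ the dimension of the span of the one-forms $m\lrcorner d\sigma_i$, $m\lrcorner d\sigma_i'$ restricted to $\mathcal V$ is smaller than the maximum of the same dimension over all $v\in\mathcal V$ at that point, (2) $\mathcal M$ meets every maximal involution nontrivially, and (3) $\mathcal M\cap\mathcal W$ is complete (Frobenius integrable) for every maximal complete subdistribution $\mathcal W$ of $\mathcal M$. A Riemann invariant of $\mathcal M$ is a locally defined smooth function $I(x,t,u,u_x,u_{xx})$ whose differential vanishes on $\mathcal M$. The system is Darboux integrable in order less than $3$ if, in neighbourhoods of generic points (a dense set of points of the space above), every Monge characteristic distribution has at least two functionally independent Riemann invariants. (For $n\ge2$ there are $n$ Monge distributions if $U$ is connected, and $u^i$ is a Riemann invariant of the $i$-th one, so that this means one invariant, of order $0$, $1$ or $2$, in addition to $u^i$, for each $i$.) Theorem. If the system is strictly hyperbolic and Darboux integrable in order less than $3$, then it is semihamiltonian: on $U$, $$\partial_j a_{ik}=\partial_k a_{ij}\qquad\text{for all pairwise distinct } i,j,k.$$ -/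

import Mathlib

open scoped ContDiff Topology

noncomputable section

namespace Hydro

/-- Functions and vectors on the space of the Riemann invariants `u = (u¹, …, uⁿ)`. -/
abbrev State (n : ℕ) : Type := Fin n → ℝ

/-- The partial derivative `∂f/∂uʲ` at `u`. -/
def pd {n : ℕ} (j : Fin n) (f : State n → ℝ) (u : State n) : ℝ :=
  fderiv ℝ f u (Pi.single j 1)

/-- The coefficients `a_{ij} = ∂_j λⁱ / (λʲ - λⁱ)` of the diagonal system `uⁱ_t = λⁱ(u) uⁱ_x`. -/
def coeffA {n : ℕ} (lam : Fin n → State n → ℝ) (i j : Fin n) (u : State n) : ℝ :=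
  pd j (lam i) u / (lam j u - lam i u)

/-- Strict hyperbolicity on `U`: the characteristic speeds are distinct at every point. -/
def StrictlyHyperbolic {n : ℕ} (U : Set (State n)) (lam : Fin n → State n → ℝ) : Prop :=
  ∀ u ∈ U, ∀ i j : Fin n, i ≠ j → lam i u ≠ lam j u

/-- The semihamiltonian property on `U`: `∂_j a_{ik} = ∂_k a_{ij}` for distinct `i, j, k`. -/
def Semihamiltonian {n : ℕ} (U : Set (State n)) (lam : Fin n → State n → ℝ) : Prop :=
  ∀ u ∈ U, ∀ i j k : Fin n, i ≠ j → i ≠ k → j ≠ k →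
    pd j (coeffA lam i k) u = pd k (coeffA lam i j) u

/-! ### Exterior systems and distributions on a normed space -/

section Distributions

variable {E : Type} [NormedAddCommGroup E] [NormedSpace ℝ E]

/-- The interior product `v ⌟ dσ` at `p`, where `dσ(v, w) = (D_v σ)(w) - (D_w σ)(v)`. -/
def contractD (σ : E → E →L[ℝ] ℝ) (p v : E) : E →L[ℝ] ℝ :=
  fderiv ℝ σ p v - (fderiv ℝ σ p).flip v

/-- The common kernel of a family of 1-forms at `p`. -/
def kerDist {ι : Type} (σ : ι → E → E →L[ℝ] ℝ) (p : E) : Submodule ℝ E :=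
  ⨅ a, LinearMap.ker (σ a p : E →ₗ[ℝ] ℝ)

/-- The dimension of the space spanned by the restrictions to `V_p = kerDist σ p` of the
1-forms `v ⌟ dσ_a`. -/
def contractRank {ι : Type} (σ : ι → E → E →L[ℝ] ℝ) (p v : E) : ℕ :=
  Module.finrank ℝ (Submodule.span ℝ (Set.range fun a : ι =>
    (contractD (σ a) p v : E →ₗ[ℝ] ℝ).domRestrict (kerDist σ p)))

/-- `S` is (the value at `p` of) an involution: `S ⊆ V_p` and all `dσ_a` vanish on `S × S`.
As `dσ_a(X, Y) = -σ_a([X, Y])` for vector fields `X, Y` tangent to `V`, this is the condition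
`[S, S] ⊆ V`, which depends on the values at `p` only. -/
def IsInvolution {ι : Type} (σ : ι → E → E →L[ℝ] ℝ) (p : E) (S : Submodule ℝ E) : Prop :=
  S ≤ kerDist σ p ∧ ∀ a, ∀ v ∈ S, ∀ w ∈ S, contractD (σ a) p v w = 0

/-- A maximal involution at `p`. -/
def IsMaxInvolution {ι : Type} (σ : ι → E → E →L[ℝ] ℝ) (p : E) (S : Submodule ℝ E) : Prop :=
  IsInvolution σ p S ∧ ∀ S', IsInvolution σ p S' → S ≤ S' → S' = S

/-- `M` is a smooth distribution on `Ω`: near every point it is spanned by a smooth frame. -/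
def IsSmoothDist (Ω : Set E) (M : E → Submodule ℝ E) : Prop :=
  ∀ p ∈ Ω, ∃ (r : ℕ) (W : Set E) (X : Fin r → E → E), IsOpen W ∧ p ∈ W ∧ W ⊆ Ω ∧
    (∀ a, ContDiffOn ℝ ∞ (X a) W) ∧
    ∀ q ∈ W, LinearIndependent ℝ (fun a => X a q) ∧
      M q = Submodule.span ℝ (Set.range fun a => X a q)

/-- `M` is complete on `Ω`: local smooth sections of `M` are closed under the Lie bracket. -/
def IsCompleteDist (Ω : Set E) (M : E → Submodule ℝ E) : Prop :=
  ∀ (W : Set E) (X Y : E → E), IsOpen W → W ⊆ Ω → ContDiffOn ℝ ∞ X W → ContDiffOn ℝ ∞ Y W →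
    (∀ q ∈ W, X q ∈ M q ∧ Y q ∈ M q) → ∀ q ∈ W, VectorField.lieBracket ℝ X Y q ∈ M q

/-- `N` is a maximal complete smooth subdistribution of `M` on `Ω`. -/
def IsMaxCompleteSub (Ω : Set E) (M N : E → Submodule ℝ E) : Prop :=
  IsSmoothDist Ω N ∧ IsCompleteDist Ω N ∧ (∀ q ∈ Ω, N q ≤ M q) ∧
    ∀ N', IsSmoothDist Ω N' → IsCompleteDist Ω N' → (∀ q ∈ Ω, N q ≤ N' q) →
      (∀ q ∈ Ω, N' q ≤ M q) → ∀ q ∈ Ω, N' q = N q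

/-- `M` is a Monge characteristic distribution on `Ω` of the exterior system `σ_a = 0`, with
`V = kerDist σ`: a smooth subdistribution of `V` such that
* `M` is singular: the rank of `m ⌟ dσ` on `V` is not maximal, for all `m ∈ M`;
* `M` meets every maximal involution nontrivially;
* `M ∩ N` is complete for every maximal complete subdistribution `N` of `M`. -/
structure IsMongeCharacteristic {ι : Type} (σ : ι → E → E →L[ℝ] ℝ) (Ω : Set E)
    (M : E → Submodule ℝ E) : Prop where
  smooth : IsSmoothDist Ω M
  sub : ∀ p ∈ Ω, M p ≤ kerDist σ p
  singular : ∀ p ∈ Ω, ∀ m ∈ M p, ∃ v ∈ kerDist σ p, contractRank σ p m < contractRank σ p v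
  meets : ∀ p ∈ Ω, ∀ S, IsMaxInvolution σ p S → M p ⊓ S ≠ ⊥
  complete : ∀ N, IsMaxCompleteSub Ω M N → IsCompleteDist Ω (fun q => M q ⊓ N q)

/-- `f` is a Riemann invariant of `M` on `W`: a smooth first integral. -/
def IsRiemannInvariant (M : E → Submodule ℝ E) (W : Set E) (f : E → ℝ) : Prop :=
  ContDiffOn ℝ ∞ f W ∧ ∀ q ∈ W, ∀ v ∈ M q, fderiv ℝ f q v = 0

/-- `M` has two functionally independent Riemann invariants near `p`. -/
def HasTwoInvariantsAt (M : E → Submodule ℝ E) (p : E) : Prop :=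
  ∃ (W : Set E) (f : Fin 2 → E → ℝ), IsOpen W ∧ p ∈ W ∧ (∀ a, IsRiemannInvariant M W (f a)) ∧
    ∀ q ∈ W, LinearIndependent ℝ (fun a => fderiv ℝ (f a) q)

end Distributions

/-! ### The exterior system of a diagonal system, prolonged to second derivatives -/

/-- The space with coordinates `(x, t, u, u_x, u_{xx})`. -/
abbrev Jet2 (n : ℕ) : Type := ℝ × ℝ × State n × State n × State n

namespace Jet2

variable {n : ℕ}

/-- The coordinate 1-form `dx`. -/
def dx : Jet2 n →L[ℝ] ℝ := ContinuousLinearMap.fst ℝ ℝ (ℝ × State n × State n × State n)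

/-- The coordinate 1-form `dt`. -/
def dt : Jet2 n →L[ℝ] ℝ :=
  ContinuousLinearMap.fst ℝ ℝ (State n × State n × State n) ∘L
    ContinuousLinearMap.snd ℝ ℝ (ℝ × State n × State n × State n)

/-- The projection to `u`. -/
def u : Jet2 n →L[ℝ] State n :=
  ContinuousLinearMap.fst ℝ (State n) (State n × State n) ∘L
    ContinuousLinearMap.snd ℝ ℝ (State n × State n × State n) ∘L
      ContinuousLinearMap.snd ℝ ℝ (ℝ × State n × State n × State n)

/-- The projection to `u_x`. -/
def ux : Jet2 n →L[ℝ] State n :=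
  ContinuousLinearMap.fst ℝ (State n) (State n) ∘L
    ContinuousLinearMap.snd ℝ (State n) (State n × State n) ∘L
      ContinuousLinearMap.snd ℝ ℝ (State n × State n × State n) ∘L
        ContinuousLinearMap.snd ℝ ℝ (ℝ × State n × State n × State n)

/-- The projection to `u_{xx}`. -/
def uxx : Jet2 n →L[ℝ] State n :=
  ContinuousLinearMap.snd ℝ (State n) (State n) ∘L
    ContinuousLinearMap.snd ℝ (State n) (State n × State n) ∘L
      ContinuousLinearMap.snd ℝ ℝ (State n × State n × State n) ∘L
        ContinuousLinearMap.snd ℝ ℝ (ℝ × State n × State n × State n)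

/-- The coordinate 1-form `duⁱ`. -/
def du (i : Fin n) : Jet2 n →L[ℝ] ℝ := ContinuousLinearMap.proj (R := ℝ) i ∘L u

/-- The coordinate 1-form `duⁱ_x`. -/
def dux (i : Fin n) : Jet2 n →L[ℝ] ℝ := ContinuousLinearMap.proj (R := ℝ) i ∘L ux

end Jet2

/-- The total derivative `D_x f = ∑_k uᵏ_x ∂_k f` of a function `f` of `u`. -/
def totalDx {n : ℕ} (f : State n → ℝ) (p : Jet2 n) : ℝ := fderiv ℝ f p.u p.ux

/-- The 1-forms of the prolonged system: on the left
`σ_i = uⁱ_x (dx + λⁱ dt) - duⁱ`, on the right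
`uⁱ_{xx} dx + D_x(λⁱ uⁱ_x) dt - duⁱ_x`, where `D_x(λⁱ uⁱ_x) = D_x(λⁱ) uⁱ_x + λⁱ uⁱ_{xx}`. -/
def jetForms {n : ℕ} (lam : Fin n → State n → ℝ) : Fin n ⊕ Fin n → Jet2 n → Jet2 n →L[ℝ] ℝ
  | Sum.inl i, p => p.ux i • (Jet2.dx + lam i p.u • Jet2.dt) - Jet2.du i
  | Sum.inr i, p => p.uxx i • Jet2.dx
      + (totalDx (lam i) p * p.ux i + lam i p.u * p.uxx i) • Jet2.dt - Jet2.dux i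

/-- The part of the jet space lying over `U`. -/
def jetDomain {n : ℕ} (U : Set (State n)) : Set (Jet2 n) := {p | p.u ∈ U}

/-- The system `uⁱ_t = λⁱ(u) uⁱ_x`, `u ∈ U`, is Darboux integrable in order less than 3: near
generic points (a dense set of them) each Monge characteristic distribution of the system
prolonged to second derivatives has two functionally independent Riemann invariants. These are
functions of `x, t, u, u_x, u_{xx}`, which is to say invariants of order 0, 1 or 2; the order may
be different for different Monge distributions. -/
def DarbouxIntegrableLT3 {n : ℕ} (U : Set (State n)) (lam : Fin n → State n → ℝ) : Prop :=
  ∀ M : Jet2 n → Submodule ℝ (Jet2 n), IsMongeCharacteristic (jetForms lam) (jetDomain U) M →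
    jetDomain U ⊆ closure {p | p ∈ jetDomain U ∧ HasTwoInvariantsAt M p}

end Hydro

end

/-!
The proof assumes that `∂_j a_{ik} ≠ ∂_k a_{ij}` at some point, for pairwise distinct `i, j, k`, and
looks at a single distribution `mongeDist lam i`. It has dimension `n`; it is spanned by the lift
`X` of the characteristic direction `D_t - λⁱ D_x` (`mongeField`) and by the `∂/∂uᵏ_{xx}` with
`k ≠ i`.

This distribution is Monge characteristic (`isMongeCharacteristic_mongeDist`). On the annihilator
`V` of the system the forms `dσ_k` vanish and `dσ_k' = ω_k ∧ θ_k`, while `mongeDist lam i` is given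
in `V` by `θ_i = ω_i = 0`. So the rank is at most `n - 1` on it, and it is `n` at `D_x`. An
involution `S` which does not meet it is at most a line, and for `v ∈ V` the `n - 1` equations
`dσ_k'(v, w) = 0`, `k ≠ i`, have a nonzero solution `w` in it, so that `S` is not maximal.

The vector fields which annihilate a given function are closed under brackets
(`fderiv_bracket_eq_zero`). Starting from the Monge distribution, brackets with `∂/∂uᵏ_{xx}` give
`Y_k = ∂/∂uᵏ_x + uⁱ_x a_{ik} ∂/∂uⁱ_{xx}` for `k ≠ i` (`firstField`), and modulo the `Y`'s the bracket
`[Y_j, [Y_k, X]]` is, up to sign,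
`uⁱ_x (λʲ - λᵏ) (∂_j a_{ik} - ∂_k a_{ij}) ∂/∂uⁱ_{xx}` (`fderiv_euxx_self_mul`). Hence, on an open set
where the semihamiltonian property fails and `uⁱ_x ≠ 0`, all invariants have order one at most. Then
they are annihilated by `T_k = ∂/∂uᵏ + uⁱ_x a_{ik} ∂/∂uⁱ_x` (`thirdField`), and
`[T_j, T_k] = uⁱ_x (∂_j a_{ik} - ∂_k a_{ij}) ∂/∂uⁱ_x` shows that they have order zero
(`fderiv_eq_of_ne`). Such an invariant is a function of `x, t, uⁱ` with `f_t = λⁱ f_x`. Since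
`a_{ij}` and `a_{ik}` do not both vanish identically, `λⁱ` depends on `uʲ` or `uᵏ` somewhere, and
there `f_x = f_t = 0` (`fderiv_eq_smul_du`): all differentials of invariants are multiples of `duⁱ`,
and no two of them are independent.
-/

noncomputable section

namespace Hydro

variable {n : ℕ}

/-! ### Coordinates on the jet space -/

namespace Jet2

@[simp] lemma dx_apply (p : Jet2 n) : dx p = p.1 := rfl
@[simp] lemma dt_apply (p : Jet2 n) : dt p = p.2.1 := rfl
@[simp] lemma u_apply (p : Jet2 n) : u p = p.2.2.1 := rfl
@[simp] lemma ux_apply (p : Jet2 n) : ux p = p.2.2.2.1 := rfl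
@[simp] lemma uxx_apply (p : Jet2 n) : uxx p = p.2.2.2.2 := rfl
@[simp] lemma du_apply (i : Fin n) (p : Jet2 n) : du i p = p.2.2.1 i := rfl
@[simp] lemma dux_apply (i : Fin n) (p : Jet2 n) : dux i p = p.2.2.2.1 i := rfl

/-- The coordinate 1-form `duⁱ_{xx}`. -/
def duxx (i : Fin n) : Jet2 n →L[ℝ] ℝ := ContinuousLinearMap.proj (R := ℝ) i ∘L uxx

@[simp] lemma duxx_apply (i : Fin n) (p : Jet2 n) : duxx i p = p.2.2.2.2 i := rfl

/-- The coordinate vector `∂/∂uᵏ`. -/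
def eu (k : Fin n) : Jet2 n := (0, 0, Pi.single k 1, 0, 0)

/-- The coordinate vector `∂/∂uᵏ_x`. -/
def eux (k : Fin n) : Jet2 n := (0, 0, 0, Pi.single k 1, 0)

/-- The coordinate vector `∂/∂uᵏ_{xx}`. -/
def euxx (k : Fin n) : Jet2 n := (0, 0, 0, 0, Pi.single k 1)

end Jet2

lemma mem_kerDist {E ι : Type} [NormedAddCommGroup E] [NormedSpace ℝ E]
    {σ : ι → E → E →L[ℝ] ℝ} {p v : E} : v ∈ kerDist σ p ↔ ∀ a, σ a p v = 0 := by
  simp [kerDist]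

/-! ### The Monge distributions -/

variable (lam : Fin n → State n → ℝ) (i : Fin n)

/-- The coefficient of `dx` in `d(D_x(λⁱ uⁱ_x)) - λⁱ duⁱ_{xx}` on the annihilator of the system,
that is `uⁱ_x D_x D_x λⁱ + 2 uⁱ_{xx} D_x λⁱ`. -/
def prolongCoeff (p : Jet2 n) : ℝ :=
  p.ux i * (fderiv ℝ (fderiv ℝ (lam i)) p.u p.ux p.ux + fderiv ℝ (lam i) p.u p.uxx)
    + 2 * p.uxx i * fderiv ℝ (lam i) p.u p.ux

/-- The 1-form `θ_i = dx + λⁱ dt`. -/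
def theta (p : Jet2 n) : Jet2 n →L[ℝ] ℝ := Jet2.dx + lam i p.u • Jet2.dt

/-- The 1-form `ω_i = duⁱ_{xx} - (prolongCoeff) dt`, for which `dσ_i' = ω_i ∧ θ_i` on the annihilator
of the system. -/
def omega (p : Jet2 n) : Jet2 n →L[ℝ] ℝ := Jet2.duxx i - prolongCoeff lam i p • Jet2.dt

/-- The vector field `D_t - λⁱ D_x + (prolongCoeff) ∂/∂uⁱ_{xx}`, the characteristic direction of the
`i`-th family lifted to the second order jets. -/
def mongeField (p : Jet2 n) : Jet2 n :=
  (-lam i p.u, 1, fun l => (lam l p.u - lam i p.u) * p.ux l,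
    fun l => totalDx (lam l) p * p.ux l + (lam l p.u - lam i p.u) * p.uxx l,
    Pi.single i (prolongCoeff lam i p))

/-- The frame of the `i`-th Monge distribution: the fields `∂/∂uᵏ_{xx}`, with the `i`-th of them
replaced by `mongeField lam i`. -/
def mongeFrame (a : Fin n) (p : Jet2 n) : Jet2 n :=
  if a = i then mongeField lam i p else Jet2.euxx a

/-- The `i`-th Monge characteristic distribution. -/
def mongeDist (p : Jet2 n) : Submodule ℝ (Jet2 n) :=
  Submodule.span ℝ (Set.range fun a => mongeFrame lam i a p)

variable {lam i}

/-- Membership in the annihilator of the system: the vector is determined by its components along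
`dx`, `dt` and `du_{xx}`. -/
lemma mem_kerDist_jetForms {p v : Jet2 n} : v ∈ kerDist (jetForms lam) p ↔
    (∀ k, v.u k = p.ux k * (v.1 + lam k p.u * v.2.1)) ∧
    ∀ k, v.ux k = p.uxx k * v.1
      + (totalDx (lam k) p * p.ux k + lam k p.u * p.uxx k) * v.2.1 := by
  rw [mem_kerDist, Sum.forall]
  refine and_congr (forall_congr' fun k => ?_) (forall_congr' fun k => ?_)
  · simp only [jetForms, sub_apply, smul_apply,
      add_apply, Jet2.dx_apply, Jet2.dt_apply, Jet2.du_apply, smul_eq_mul,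
      Jet2.u_apply]
    constructor <;> intro h <;> linarith
  · simp only [jetForms, sub_apply, smul_apply,
      add_apply, Jet2.dx_apply, Jet2.dt_apply, Jet2.dux_apply, smul_eq_mul,
      Jet2.ux_apply]
    constructor <;> intro h <;> linarith

lemma u_eq_of_mem_kerDist {p v : Jet2 n} (hv : v ∈ kerDist (jetForms lam) p) :
    v.2.2.1 = v.1 • p.ux + v.2.1 • fun k => lam k p.u * p.ux k := by
  ext l
  have := (mem_kerDist_jetForms.1 hv).1 l
  simp only [Jet2.u_apply] at this
  simp [this]
  ring

lemma ux_eq_of_mem_kerDist {p v : Jet2 n} (hv : v ∈ kerDist (jetForms lam) p) :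
    v.2.2.2.1 = v.1 • p.uxx
      + v.2.1 • fun k => totalDx (lam k) p * p.ux k + lam k p.u * p.uxx k := by
  ext l
  have := (mem_kerDist_jetForms.1 hv).2 l
  simp only [Jet2.ux_apply] at this
  simp [this]
  ring

lemma euxx_mem_kerDist (k : Fin n) (p : Jet2 n) : Jet2.euxx k ∈ kerDist (jetForms lam) p := by
  rw [mem_kerDist_jetForms]
  simp [Jet2.euxx]

lemma mongeField_mem_kerDist (p : Jet2 n) : mongeField lam i p ∈ kerDist (jetForms lam) p := by
  rw [mem_kerDist_jetForms]
  constructor <;> intro k <;> simp [mongeField] <;> ring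

/-- The Monge distribution is cut out of the annihilator by `θ_i` and `ω_i`. -/
lemma mem_mongeDist {p v : Jet2 n} : v ∈ mongeDist lam i p ↔
    v ∈ kerDist (jetForms lam) p ∧ theta lam i p v = 0 ∧ omega lam i p v = 0 := by
  constructor
  · intro hv
    have : mongeDist lam i p ≤ kerDist (jetForms lam) p ⊓
        (LinearMap.ker (theta lam i p : Jet2 n →ₗ[ℝ] ℝ) ⊓
          LinearMap.ker (omega lam i p : Jet2 n →ₗ[ℝ] ℝ)) := by
      rw [mongeDist, Submodule.span_le]
      rintro _ ⟨a, rfl⟩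
      by_cases ha : a = i
      · simp only [mongeFrame, ha, if_true]
        refine ⟨mongeField_mem_kerDist p, ?_, ?_⟩
        · simp [theta, mongeField]
        · simp [omega, mongeField]
      · simp only [mongeFrame, ha, if_false]
        refine ⟨euxx_mem_kerDist a p, ?_, ?_⟩
        · simp [theta, Jet2.euxx]
        · simp [omega, Jet2.euxx, Ne.symm ha]
    simpa using this hv
  · rintro ⟨hV, hθ, hω⟩
    obtain ⟨h1, h2⟩ := mem_kerDist_jetForms.1 hV
    simp only [theta, omega, add_apply, sub_apply,
      smul_apply, Jet2.dx_apply, Jet2.dt_apply, Jet2.duxx_apply,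
      smul_eq_mul] at hθ hω
    have key : v = v.2.1 • mongeField lam i p
        + ∑ a ∈ Finset.univ.erase i, v.2.2.2.2 a • Jet2.euxx a := by
      have hsum : ∑ a ∈ Finset.univ.erase i, v.2.2.2.2 a • Jet2.euxx a
          = ((0, 0, 0, 0, fun l => if l = i then 0 else v.2.2.2.2 l) : Jet2 n) := by
        have : ∀ a, v.2.2.2.2 a • Jet2.euxx a
            = ((0, 0, 0, 0, Pi.single a (v.2.2.2.2 a)) : Jet2 n) := by
          intro a
          simp [Jet2.euxx, ← Pi.single_smul]
        simp only [this]
        refine Prod.ext ?_ (Prod.ext ?_ (Prod.ext ?_ (Prod.ext ?_ ?_)))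
        · simp [Prod.fst_sum]
        · simp [Prod.fst_sum, Prod.snd_sum]
        · simp [Prod.fst_sum, Prod.snd_sum]
        · simp [Prod.fst_sum, Prod.snd_sum]
        · ext l
          simp only [Prod.snd_sum, Finset.sum_apply, Pi.single_apply, Finset.sum_ite_eq,
            Finset.mem_erase, Finset.mem_univ, and_true]
          split_ifs <;> simp_all
      rw [hsum]
      have hx : v.1 = -(lam i p.u * v.2.1) := by linarith
      refine Prod.ext ?_ (Prod.ext ?_ (Prod.ext ?_ (Prod.ext ?_ ?_)))
      · simp [mongeField, hx, mul_comm]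
      · simp [mongeField]
      · ext l
        have := h1 l
        simp only [Jet2.u_apply] at this
        simp [mongeField, this, hx]
        ring
      · ext l
        have := h2 l
        simp only [Jet2.ux_apply] at this
        simp [mongeField, this, hx]
        ring
      · ext l
        by_cases hl : l = i
        · subst hl
          simp [mongeField]
          linarith
        · simp [mongeField, hl]
    rw [key]
    refine Submodule.add_mem _ (Submodule.smul_mem _ _ ?_) (Submodule.sum_mem _ fun a ha =>
      Submodule.smul_mem _ _ ?_)
    · exact Submodule.subset_span ⟨i, by simp [mongeFrame]⟩
    · exact Submodule.subset_span ⟨a, by simp [mongeFrame, Finset.ne_of_mem_erase ha]⟩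

lemma linearIndependent_mongeFrame (p : Jet2 n) :
    LinearIndependent ℝ (fun a => mongeFrame lam i a p) := by
  rw [Fintype.linearIndependent_iff]
  intro g hg
  have hi : g i = 0 := by
    have := congrArg Jet2.dt hg
    rw [map_sum, Finset.sum_eq_single i] at this
    · simpa [mongeFrame, mongeField] using this
    · intro b _ hb
      simp [mongeFrame, hb, Jet2.euxx]
    · simp
  intro a
  by_cases ha : a = i
  · rw [ha, hi]
  have := congrArg (Jet2.duxx a) hg
  rw [map_sum, Finset.sum_eq_single a] at this
  · simpa [mongeFrame, ha, Jet2.euxx] using this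
  · intro b _ hb
    by_cases hbi : b = i
    · simp [hbi, hi]
    · simp [mongeFrame, hbi, Jet2.euxx, Ne.symm hb]
  · simp

/-! ### Smoothness -/

lemma isOpen_jetDomain {U : Set (State n)} (hU : IsOpen U) : IsOpen (jetDomain U) :=
  hU.preimage Jet2.u.continuous

variable {U : Set (State n)}

lemma contDiffOn_comp_u {F : Type*} [NormedAddCommGroup F] [NormedSpace ℝ F] {g : State n → F}
    (hg : ContDiffOn ℝ ∞ g U) : ContDiffOn ℝ ∞ (fun p : Jet2 n => g p.u) (jetDomain U) :=
  hg.comp Jet2.u.contDiff.contDiffOn fun _ hp => hp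

lemma contDiffOn_fderiv {F : Type*} [NormedAddCommGroup F] [NormedSpace ℝ F] {g : State n → F}
    (hU : IsOpen U) (hg : ContDiffOn ℝ ∞ g U) : ContDiffOn ℝ ∞ (fderiv ℝ g) U :=
  hg.fderiv_of_isOpen hU (by simp)

lemma contDiffOn_totalDx (hU : IsOpen U) {g : State n → ℝ} (hg : ContDiffOn ℝ ∞ g U) :
    ContDiffOn ℝ ∞ (totalDx g) (jetDomain U) :=
  (contDiffOn_comp_u (contDiffOn_fderiv hU hg)).clm_apply Jet2.ux.contDiff.contDiffOn

lemma contDiff_ux (k : Fin n) : ContDiff ℝ ∞ fun p : Jet2 n => p.ux k := (Jet2.dux k).contDiff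

lemma contDiff_uxx (k : Fin n) : ContDiff ℝ ∞ fun p : Jet2 n => p.uxx k := (Jet2.duxx k).contDiff

lemma contDiffOn_prolongCoeff (hU : IsOpen U) (hlam : ∀ i, ContDiffOn ℝ ∞ (lam i) U) (i : Fin n) :
    ContDiffOn ℝ ∞ (prolongCoeff lam i) (jetDomain U) := by
  have h1 := contDiffOn_fderiv hU (hlam i)
  have hux : ContDiffOn ℝ ∞ (fun p : Jet2 n => p.ux) (jetDomain U) := Jet2.ux.contDiff.contDiffOn
  have huxx : ContDiffOn ℝ ∞ (fun p : Jet2 n => p.uxx) (jetDomain U) :=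
    Jet2.uxx.contDiff.contDiffOn
  exact ((contDiff_ux i).contDiffOn.mul
    ((((contDiffOn_comp_u (contDiffOn_fderiv hU h1)).clm_apply hux).clm_apply hux).add
      ((contDiffOn_comp_u h1).clm_apply huxx))).add
    ((contDiffOn_const.mul (contDiff_uxx i).contDiffOn).mul ((contDiffOn_comp_u h1).clm_apply hux))

lemma contDiffOn_mongeField (hU : IsOpen U) (hlam : ∀ i, ContDiffOn ℝ ∞ (lam i) U) (i : Fin n) :
    ContDiffOn ℝ ∞ (mongeField lam i) (jetDomain U) := by
  have hl : ∀ k, ContDiffOn ℝ ∞ (fun p : Jet2 n => lam k p.u) (jetDomain U) :=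
    fun k => contDiffOn_comp_u (hlam k)
  refine (hl i).neg.prodMk (contDiffOn_const.prodMk (ContDiffOn.prodMk ?_
    (ContDiffOn.prodMk ?_ ?_)))
  · exact contDiffOn_pi.2 fun l => ((hl l).sub (hl i)).mul (contDiff_ux l).contDiffOn
  · exact contDiffOn_pi.2 fun l => ((contDiffOn_totalDx hU (hlam l)).mul
      (contDiff_ux l).contDiffOn).add (((hl l).sub (hl i)).mul (contDiff_uxx l).contDiffOn)
  · exact (ContinuousLinearMap.single ℝ (fun _ : Fin n => ℝ) i).contDiff.comp_contDiffOn
      (contDiffOn_prolongCoeff hU hlam i)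

/-! ### The structure equations -/

lemma hasFDerivAt_comp_u {F : Type*} [NormedAddCommGroup F] [NormedSpace ℝ F] {g : State n → F}
    (hU : IsOpen U) (hg : ContDiffOn ℝ ∞ g U) {p : Jet2 n} (hp : p ∈ jetDomain U) :
    HasFDerivAt (fun p : Jet2 n => g p.u) (fderiv ℝ g p.u ∘L Jet2.u) p :=
  ((hg.contDiffAt (hU.mem_nhds hp)).differentiableAt (by simp)).hasFDerivAt.comp p
    Jet2.u.hasFDerivAt

lemma hasFDerivAt_totalDx {g : State n → ℝ} (hU : IsOpen U) (hg : ContDiffOn ℝ ∞ g U)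
    {p : Jet2 n} (hp : p ∈ jetDomain U) :
    HasFDerivAt (totalDx g) (fderiv ℝ g p.u ∘L Jet2.ux +
      (fderiv ℝ (fderiv ℝ g) p.u ∘L Jet2.u).flip p.ux) p :=
  (hasFDerivAt_comp_u hU (contDiffOn_fderiv hU hg) hp).clm_apply Jet2.ux.hasFDerivAt

lemma hasFDerivAt_ux (k : Fin n) (p : Jet2 n) :
    HasFDerivAt (fun p : Jet2 n => p.ux k) (Jet2.dux k) p := (Jet2.dux k).hasFDerivAt

lemma hasFDerivAt_uxx (k : Fin n) (p : Jet2 n) :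
    HasFDerivAt (fun p : Jet2 n => p.uxx k) (Jet2.duxx k) p := (Jet2.duxx k).hasFDerivAt

lemma contractD_apply {E : Type} [NormedAddCommGroup E] [NormedSpace ℝ E]
    (σ : E → E →L[ℝ] ℝ) (p v w : E) :
    contractD σ p v w = fderiv ℝ σ p v w - fderiv ℝ σ p w v := rfl

/-- `dσ_k` vanishes on the annihilator of the system. -/
lemma contractD_inl (hU : IsOpen U) (hlam : ∀ i, ContDiffOn ℝ ∞ (lam i) U) (k : Fin n)
    {p v w : Jet2 n} (hp : p ∈ jetDomain U) (hv : v ∈ kerDist (jetForms lam) p)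
    (hw : w ∈ kerDist (jetForms lam) p) :
    contractD (jetForms lam (Sum.inl k)) p v w = 0 := by
  have hd : HasFDerivAt (jetForms lam (Sum.inl k)) _ p :=
    (((hasFDerivAt_ux k p).smul ((hasFDerivAt_const (Jet2.dx (n := n)) p).add
      ((hasFDerivAt_comp_u hU (hlam k) hp).smul_const Jet2.dt))).sub
        (hasFDerivAt_const (Jet2.du k) p))
  have hv' := (mem_kerDist_jetForms.1 hv).2 k
  have hw' := (mem_kerDist_jetForms.1 hw).2 k
  simp only [Jet2.ux_apply] at hv' hw'
  rw [contractD_apply, hd.fderiv]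
  simp only [add_apply, smul_apply, ContinuousLinearMap.smulRight_apply, Jet2.dux_apply,
    ContinuousLinearMap.comp_apply, Jet2.dt_apply, smul_eq_mul, Jet2.u_apply v,
    Jet2.u_apply w, u_eq_of_mem_kerDist hv, u_eq_of_mem_kerDist hw, map_add, map_smul,
    zero_add, sub_zero, hv', hw', totalDx]
  simp
  ring

/-- `dσ_k' = ω_k ∧ θ_k` on the annihilator of the system. -/
lemma contractD_inr (hU : IsOpen U) (hlam : ∀ i, ContDiffOn ℝ ∞ (lam i) U) (k : Fin n)
    {p v w : Jet2 n} (hp : p ∈ jetDomain U) (hv : v ∈ kerDist (jetForms lam) p)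
    (hw : w ∈ kerDist (jetForms lam) p) :
    contractD (jetForms lam (Sum.inr k)) p v w =
      omega lam k p v * theta lam k p w - theta lam k p v * omega lam k p w := by
  have hd : HasFDerivAt (jetForms lam (Sum.inr k)) _ p :=
    ((((hasFDerivAt_uxx k p).smul (hasFDerivAt_const (Jet2.dx (n := n)) p)).add
      ((((hasFDerivAt_totalDx hU (hlam k) hp).mul (hasFDerivAt_ux k p)).add
        ((hasFDerivAt_comp_u hU (hlam k) hp).mul (hasFDerivAt_uxx k p))).smul_const Jet2.dt)).sub
        (hasFDerivAt_const (Jet2.dux k) p))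
  rw [contractD_apply, hd.fderiv]
  simp only [sub_apply, add_apply, smul_apply, ContinuousLinearMap.smulRight_apply,
    Jet2.dux_apply, Jet2.duxx_apply, ContinuousLinearMap.flip_apply,
    ContinuousLinearMap.comp_apply, Jet2.dx_apply, Jet2.dt_apply, smul_eq_mul, Jet2.u_apply v,
    Jet2.u_apply w, Jet2.ux_apply v, Jet2.ux_apply w, u_eq_of_mem_kerDist hv,
    u_eq_of_mem_kerDist hw, ux_eq_of_mem_kerDist hv, ux_eq_of_mem_kerDist hw, map_add, map_smul,
    zero_apply, sub_zero, theta, omega, prolongCoeff]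
  simp [totalDx]
  ring

/-! ### The Monge distributions are Monge characteristic -/

lemma contractRank_lt_of_mem_mongeDist (hU : IsOpen U) (hlam : ∀ i, ContDiffOn ℝ ∞ (lam i) U)
    {p m : Jet2 n} (hp : p ∈ jetDomain U) (hm : m ∈ mongeDist lam i p) :
    contractRank (jetForms lam) p m < n := by
  classical
  obtain ⟨hV, hθ, hω⟩ := mem_mongeDist.1 hm
  set B : Fin n ⊕ Fin n → (kerDist (jetForms lam) p →ₗ[ℝ] ℝ) := fun a =>
    (contractD (jetForms lam a) p m : Jet2 n →ₗ[ℝ] ℝ).domRestrict (kerDist (jetForms lam) p)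
    with hB
  have hinl : ∀ k, B (Sum.inl k) = 0 := fun k => by
    ext ⟨w, hw⟩
    exact contractD_inl hU hlam k hp hV hw
  have hi : B (Sum.inr i) = 0 := by
    ext ⟨w, hw⟩
    have := contractD_inr hU hlam i hp hV hw
    rw [hθ, hω] at this
    simpa [hB] using this
  have hle : Submodule.span ℝ (Set.range B) ≤ Submodule.span ℝ
      (((Finset.univ.erase i).image fun k => B (Sum.inr k) : Finset _) : Set _) := by
    rw [Submodule.span_le]
    rintro _ ⟨a | k, rfl⟩
    · rw [hinl]
      exact Submodule.zero_mem _
    · by_cases hk : k = i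
      · rw [hk, hi]
        exact Submodule.zero_mem _
      · exact Submodule.subset_span (by simpa using ⟨k, hk, rfl⟩)
  have hn : 0 < n := i.pos
  calc contractRank (jetForms lam) p m
      ≤ _ := Submodule.finrank_mono hle
    _ ≤ ((Finset.univ.erase i).image fun k => B (Sum.inr k)).card := finrank_span_finset_le_card _
    _ ≤ (Finset.univ.erase i).card := Finset.card_image_le
    _ < n := by
      rw [Finset.card_erase_of_mem (Finset.mem_univ i), Finset.card_fin]
      omega

/-- The rank of `D_x ⌟ dσ` is at least `n`: the forms `D_x ⌟ dσ_k'` are dual, up to sign, to the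
vectors `∂/∂uᵏ_{xx}`. -/
lemma exists_le_contractRank (hU : IsOpen U) (hlam : ∀ i, ContDiffOn ℝ ∞ (lam i) U)
    {p : Jet2 n} (hp : p ∈ jetDomain U) :
    ∃ v ∈ kerDist (jetForms lam) p, n ≤ contractRank (jetForms lam) p v := by
  have hv : ((1, 0, p.ux, p.uxx, 0) : Jet2 n) ∈ kerDist (jetForms lam) p := by
    rw [mem_kerDist_jetForms]
    simp
  refine ⟨_, hv, ?_⟩
  set v : Jet2 n := (1, 0, p.ux, p.uxx, 0) with hvdef
  set B : Fin n ⊕ Fin n → (kerDist (jetForms lam) p →ₗ[ℝ] ℝ) := fun a =>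
    (contractD (jetForms lam a) p v : Jet2 n →ₗ[ℝ] ℝ).domRestrict (kerDist (jetForms lam) p)
    with hB
  have hval : ∀ k j, B (Sum.inr k) ⟨Jet2.euxx j, euxx_mem_kerDist j p⟩
      = -(Pi.single j 1 : Fin n → ℝ) k := by
    intro k j
    have := contractD_inr hU hlam k hp hv (euxx_mem_kerDist j p)
    simpa [hB, theta, omega, Jet2.euxx, hvdef] using this
  have hli : LinearIndependent ℝ fun k => B (Sum.inr k) := by
    rw [Fintype.linearIndependent_iff]
    intro g hg j
    have := LinearMap.congr_fun hg ⟨Jet2.euxx j, euxx_mem_kerDist j p⟩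
    simpa [hval, Pi.single_apply] using this
  calc n = Module.finrank ℝ (Submodule.span ℝ (Set.range fun k => B (Sum.inr k))) := by
        rw [finrank_span_eq_card hli, Fintype.card_fin]
    _ ≤ Module.finrank ℝ (Submodule.span ℝ (Set.range B)) :=
        Submodule.finrank_mono (Submodule.span_mono (by rintro _ ⟨k, rfl⟩; exact ⟨_, rfl⟩))
    _ = contractRank (jetForms lam) p v := rfl

lemma exists_mem_mongeDist_ne_zero_contractD_eq_zero (hU : IsOpen U)
    (hlam : ∀ i, ContDiffOn ℝ ∞ (lam i) U) {p v : Jet2 n} (hp : p ∈ jetDomain U)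
    (hv : v ∈ kerDist (jetForms lam) p) :
    ∃ w ∈ mongeDist lam i p, w ≠ 0 ∧ ∀ a, contractD (jetForms lam a) p v w = 0 := by
  -- On the `n`-dimensional Monge distribution only the `n - 1` conditions with `k ≠ i` are left.
  let T : mongeDist lam i p →ₗ[ℝ] ({k : Fin n // k ≠ i} → ℝ) :=
    LinearMap.pi fun k => (contractD (jetForms lam (Sum.inr k.1)) p v :
      Jet2 n →ₗ[ℝ] ℝ).domRestrict (mongeDist lam i p)
  have hdim : Module.finrank ℝ ({k : Fin n // k ≠ i} → ℝ)
      < Module.finrank ℝ (mongeDist lam i p) := by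
    rw [mongeDist, finrank_span_eq_card (linearIndependent_mongeFrame p), Fintype.card_fin,
      Module.finrank_fintype_fun_eq_card, Fintype.card_subtype_compl, Fintype.card_fin,
      Fintype.card_subtype_eq]
    have := i.pos
    omega
  obtain ⟨⟨w, hw⟩, hwT, hw0⟩ := (Submodule.ne_bot_iff _).1 (LinearMap.ker_ne_bot_of_finrank_lt
    (f := T) hdim)
  obtain ⟨hwV, hθ, hω⟩ := mem_mongeDist.1 hw
  refine ⟨w, hw, fun h => hw0 (by simpa using h), ?_⟩
  rintro (k | k)
  · exact contractD_inl hU hlam k hp hv hwV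
  · by_cases hk : k = i
    · rw [hk, contractD_inr hU hlam i hp hv hwV, hθ, hω]
      simp
    · exact congrFun (LinearMap.mem_ker.1 hwT) ⟨k, hk⟩

lemma contractD_self {E : Type} [NormedAddCommGroup E] [NormedSpace ℝ E]
    (σ : E → E →L[ℝ] ℝ) (p v : E) : contractD σ p v v = 0 := sub_self _

lemma contractD_swap {E : Type} [NormedAddCommGroup E] [NormedSpace ℝ E]
    (σ : E → E →L[ℝ] ℝ) (p v w : E) : contractD σ p w v = -contractD σ p v w :=
  (neg_sub _ _).symm

/-- An involution which misses the Monge distribution is at most a line, as `ω_i ∧ θ_i` vanishes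
on it, and then it can be enlarged by a vector of the Monge distribution. -/
lemma mongeDist_inf_ne_bot (hU : IsOpen U) (hlam : ∀ i, ContDiffOn ℝ ∞ (lam i) U) {p : Jet2 n}
    (hp : p ∈ jetDomain U) {S : Submodule ℝ (Jet2 n)}
    (hS : IsMaxInvolution (jetForms lam) p S) : mongeDist lam i p ⊓ S ≠ ⊥ := by
  intro hbot
  obtain ⟨⟨hSV, hSσ⟩, hmax⟩ := hS
  have hzero : ∀ x ∈ S, theta lam i p x = 0 → omega lam i p x = 0 → x = 0 := by
    intro x hx h1 h2
    have : x ∈ mongeDist lam i p ⊓ S := ⟨mem_mongeDist.2 ⟨hSV hx, h1, h2⟩, hx⟩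
    simpa [hbot] using this
  have hwedge : ∀ v ∈ S, ∀ w ∈ S,
      omega lam i p v * theta lam i p w - theta lam i p v * omega lam i p w = 0 := by
    intro v hv w hw
    rw [← contractD_inr hU hlam i hp (hSV hv) (hSV hw)]
    exact hSσ _ v hv w hw
  obtain ⟨v, hvS, hline⟩ : ∃ v ∈ S, ∀ x ∈ S, ∃ c : ℝ, x = c • v := by
    by_cases h0 : S = ⊥
    · exact ⟨0, S.zero_mem, fun x hx => ⟨0, by simpa [h0] using hx⟩⟩
    obtain ⟨v, hvS, hv0⟩ := (Submodule.ne_bot_iff _).1 h0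
    refine ⟨v, hvS, fun x hx => ?_⟩
    have hw := hwedge v hvS x hx
    by_cases hθ : theta lam i p v = 0
    · have hω : omega lam i p v ≠ 0 := fun h => hv0 (hzero v hvS hθ h)
      have hθx : theta lam i p x = 0 := by
        rw [hθ, zero_mul, sub_zero] at hw
        exact (mul_eq_zero.1 hw).resolve_left hω
      refine ⟨omega lam i p x / omega lam i p v, sub_eq_zero.1 (hzero _
        (S.sub_mem hx (S.smul_mem _ hvS)) ?_ ?_)⟩
      · rw [map_sub, map_smul, hθ, hθx]
        simp
      · rw [map_sub, map_smul, smul_eq_mul]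
        field_simp
        ring
    · refine ⟨theta lam i p x / theta lam i p v, sub_eq_zero.1 (hzero _
        (S.sub_mem hx (S.smul_mem _ hvS)) ?_ ?_)⟩
      · rw [map_sub, map_smul, smul_eq_mul]
        field_simp
        ring
      · rw [map_sub, map_smul, smul_eq_mul]
        field_simp
        linarith
  obtain ⟨w, hw, hw0, hvw⟩ :=
    exists_mem_mongeDist_ne_zero_contractD_eq_zero (i := i) hU hlam hp (hSV hvS)
  have hwV := (mem_mongeDist.1 hw).1
  have hinv : IsInvolution (jetForms lam) p (S ⊔ Submodule.span ℝ {w}) := by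
    refine ⟨sup_le hSV ((Submodule.span_singleton_le_iff_mem _ _).2 hwV), ?_⟩
    intro a x hx y hy
    obtain ⟨x1, hx1, x2, hx2, rfl⟩ := Submodule.mem_sup.1 hx
    obtain ⟨y1, hy1, y2, hy2, rfl⟩ := Submodule.mem_sup.1 hy
    obtain ⟨c, rfl⟩ := hline x1 hx1
    obtain ⟨d, rfl⟩ := hline y1 hy1
    obtain ⟨e, rfl⟩ := Submodule.mem_span_singleton.1 hx2
    obtain ⟨f, rfl⟩ := Submodule.mem_span_singleton.1 hy2
    have h1 : ∀ z : Jet2 n, contractD (jetForms lam a) p (c • v + e • w) z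
        = c * contractD (jetForms lam a) p v z + e * contractD (jetForms lam a) p w z := by
      intro z
      simp only [contractD_apply, map_add, map_smul, add_apply, smul_apply, smul_eq_mul]
      ring
    rw [h1]
    simp only [map_add, map_smul, contractD_self, hvw, contractD_swap _ p v w]
    simp
  have hSw : w ∈ S := by
    rw [← hmax _ hinv le_sup_left]
    exact Submodule.mem_sup_right (Submodule.mem_span_singleton_self w)
  have : w ∈ mongeDist lam i p ⊓ S := ⟨hw, hSw⟩
  rw [hbot] at this
  exact hw0 (by simpa using this)

theorem isMongeCharacteristic_mongeDist (hU : IsOpen U)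
    (hlam : ∀ i, ContDiffOn ℝ ∞ (lam i) U) (i : Fin n) :
    IsMongeCharacteristic (jetForms lam) (jetDomain U) (mongeDist lam i) where
  smooth p hp := by
    refine ⟨n, jetDomain U, mongeFrame lam i, isOpen_jetDomain hU, hp, subset_rfl, fun a => ?_,
      fun q _ => ⟨linearIndependent_mongeFrame q, rfl⟩⟩
    by_cases ha : a = i
    · exact (contDiffOn_mongeField hU hlam i).congr fun q _ => if_pos ha
    · exact (contDiffOn_const (c := Jet2.euxx a)).congr fun q _ => if_neg ha
  sub p _ _ hv := (mem_mongeDist.1 hv).1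
  singular p hp m hm := by
    obtain ⟨v, hv, hn⟩ := exists_le_contractRank hU hlam hp
    exact ⟨v, hv, (contractRank_lt_of_mem_mongeDist hU hlam hp hm).trans_le hn⟩
  meets p hp S hS := mongeDist_inf_ne_bot hU hlam hp hS
  complete N hN W X Y hW hWΩ hX hY hXY q hq := by
    -- `N` lies in the Monge distribution, so that intersecting it changes nothing.
    have hb := hN.2.1 W X Y hW hWΩ hX hY (fun q hq => ⟨(hXY q hq).1.2, (hXY q hq).2.2⟩) q hq
    exact ⟨hN.2.2.1 q (hWΩ hq) hb, hb⟩

/-! ### Vector fields which annihilate a function -/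

section Bracket

variable {E : Type} [NormedAddCommGroup E] [NormedSpace ℝ E]

/-- The vector fields which annihilate a smooth function are closed under the Lie bracket. -/
lemma fderiv_bracket_eq_zero {f : E → ℝ} {W : Set E} (hW : IsOpen W) (hf : ContDiffOn ℝ ∞ f W)
    {X Y : E → E} (hX : ∀ q ∈ W, fderiv ℝ f q (X q) = 0) (hY : ∀ q ∈ W, fderiv ℝ f q (Y q) = 0)
    {p : E} (hp : p ∈ W) {X' Y' : E →L[ℝ] E} (hX' : HasFDerivAt X X' p)
    (hY' : HasFDerivAt Y Y' p) : fderiv ℝ f p (Y' (X p) - X' (Y p)) = 0 := by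
  have hfp : ContDiffAt ℝ ∞ f p := hf.contDiffAt (hW.mem_nhds hp)
  have hd : HasFDerivAt (fderiv ℝ f) (fderiv ℝ (fderiv ℝ f) p) p :=
    ((hfp.fderiv_right (m := ∞) (by simp)).differentiableAt (by simp)).hasFDerivAt
  have hsymm : IsSymmSndFDerivAt ℝ f p := hfp.isSymmSndFDerivAt
    (by rw [minSmoothness_of_isRCLikeNormedField]; exact ENat.LEInfty.out)
  -- Differentiate `df(Z) = 0`; the terms with `D²f` cancel by symmetry.
  have key : ∀ {Z : E → E} {Z' : E →L[ℝ] E}, (∀ q ∈ W, fderiv ℝ f q (Z q) = 0) →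
      HasFDerivAt Z Z' p → ∀ v, fderiv ℝ f p (Z' v) + fderiv ℝ (fderiv ℝ f) p v (Z p) = 0 := by
    intro Z Z' hZ hZ' v
    have h0 : (fun q => fderiv ℝ f q (Z q)) =ᶠ[𝓝 p] fun _ => 0 :=
      Filter.eventually_of_mem (hW.mem_nhds hp) hZ
    have h1 := (hd.clm_apply hZ').fderiv
    rw [h0.fderiv_eq, fderiv_fun_const] at h1
    simpa using (DFunLike.congr_fun h1 v).symm
  have h1 := key hX hX' (Y p)
  have h2 := key hY hY' (X p)
  have h3 := hsymm (X p) (Y p)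
  rw [map_sub]
  linarith

end Bracket

lemma contDiffOn_pd (hU : IsOpen U) {g : State n → ℝ} (hg : ContDiffOn ℝ ∞ g U) (k : Fin n) :
    ContDiffOn ℝ ∞ (pd k g) U :=
  (contDiffOn_fderiv hU hg).clm_apply contDiffOn_const

lemma contDiffOn_coeffA (hU : IsOpen U) (hlam : ∀ i, ContDiffOn ℝ ∞ (lam i) U)
    (hyp : StrictlyHyperbolic U lam) {k : Fin n} (hk : k ≠ i) :
    ContDiffOn ℝ ∞ (coeffA lam i k) U :=
  (contDiffOn_pd hU (hlam i) k).div ((hlam k).sub (hlam i)) fun u hu =>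
    sub_ne_zero.2 (hyp u hu k i hk)

lemma pd_eq_coeffA_mul (hyp : StrictlyHyperbolic U lam) {k : Fin n} (hk : k ≠ i) {u : State n}
    (hu : u ∈ U) : pd k (lam i) u = coeffA lam i k u * (lam k u - lam i u) :=
  (div_mul_cancel₀ _ (sub_ne_zero.2 (hyp u hu k i hk))).symm

/-- The second derivatives of `λⁱ` in terms of the coefficients `a_{ik}`. -/
lemma pd_pd_eq (hU : IsOpen U) (hlam : ∀ i, ContDiffOn ℝ ∞ (lam i) U)
    (hyp : StrictlyHyperbolic U lam) {k : Fin n} (hk : k ≠ i) (j : Fin n) {u : State n}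
    (hu : u ∈ U) : fderiv ℝ (fderiv ℝ (lam i)) u (Pi.single j 1) (Pi.single k 1) =
      pd j (coeffA lam i k) u * (lam k u - lam i u)
        + coeffA lam i k u * (pd j (lam k) u - pd j (lam i) u) := by
  have hd : ∀ {F : Type} [NormedAddCommGroup F] [NormedSpace ℝ F] {g : State n → F},
      ContDiffOn ℝ ∞ g U → HasFDerivAt g (fderiv ℝ g u) u := fun {F} _ _ {g} hg =>
    ((hg.contDiffAt (hU.mem_nhds hu)).differentiableAt (by simp)).hasFDerivAt
  have h1 := ((hd (contDiffOn_fderiv hU (hlam i))).clm_apply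
    (hasFDerivAt_const (Pi.single k 1 : State n) u)).fderiv
  have h2 := ((hd (contDiffOn_coeffA hU hlam hyp hk)).mul ((hd (hlam k)).sub (hd (hlam i)))).fderiv
  have heq : (fun v => fderiv ℝ (lam i) v (Pi.single k 1 : State n)) =ᶠ[𝓝 u]
      (fun v => coeffA lam i k v * (lam k v - lam i v)) :=
    Filter.eventually_of_mem (hU.mem_nhds hu) fun v hv => pd_eq_coeffA_mul hyp hk hv
  rw [heq.fderiv_eq] at h1
  have h3 := DFunLike.congr_fun (h1.symm.trans h2) (Pi.single j 1)
  simp at h3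
  rw [h3]
  simp only [pd]
  ring

lemma fderiv_fderiv_symm (hU : IsOpen U) {g : State n → ℝ} (hg : ContDiffOn ℝ ∞ g U)
    {u : State n} (hu : u ∈ U) (v w : State n) :
    fderiv ℝ (fderiv ℝ g) u v w = fderiv ℝ (fderiv ℝ g) u w v :=
  (hg.contDiffAt (hU.mem_nhds hu)).isSymmSndFDerivAt
    (by rw [minSmoothness_of_isRCLikeNormedField]; exact ENat.LEInfty.out) v w

/-! ### Brackets of the Monge distribution -/

variable (lam i)

/-- The vector field `∂/∂uᵏ_x + uⁱ_x a_{ik} ∂/∂uⁱ_{xx}`, which for `k ≠ i` is the bracket of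
`∂/∂uᵏ_{xx}` and `mongeField lam i`, divided by `λᵏ - λⁱ`. -/
def firstField (k : Fin n) (p : Jet2 n) : Jet2 n :=
  (0, 0, 0, Pi.single k 1, Pi.single i (p.ux i * coeffA lam i k p.u))

/-- The component along `∂/∂uⁱ_{xx}` of the bracket of `firstField lam i k` and
`mongeField lam i`. -/
def secondCoeff (k : Fin n) (p : Jet2 n) : ℝ :=
  p.ux i * (2 * fderiv ℝ (fderiv ℝ (lam i)) p.u (Pi.single k 1) p.ux
      + p.ux i * coeffA lam i k p.u * pd i (lam i) p.u)
    + p.ux i * coeffA lam i k p.u * fderiv ℝ (lam i) p.u p.ux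
    + 2 * p.uxx i * pd k (lam i) p.u
    - p.ux i * fderiv ℝ (coeffA lam i k) p.u (fun l => (lam l p.u - lam i p.u) * p.ux l)

/-- The bracket of `firstField lam i k` and `mongeField lam i`, for `k ≠ i`. -/
def secondField (k : Fin n) (p : Jet2 n) : Jet2 n :=
  (0, 0, Pi.single k (lam k p.u - lam i p.u),
    fun l => pd k (lam l) p.u * p.ux l + (Pi.single k (totalDx (lam k) p) : State n) l,
    Pi.single i (secondCoeff lam i k p))

variable {lam i}

lemma hasFDerivAt_single {g : Jet2 n → ℝ} {g' : Jet2 n →L[ℝ] ℝ} {p : Jet2 n} (k : Fin n)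
    (hg : HasFDerivAt g g' p) : HasFDerivAt (fun q => (Pi.single k (g q) : State n))
      (ContinuousLinearMap.single ℝ (fun _ : Fin n => ℝ) k ∘L g') p :=
  (ContinuousLinearMap.single ℝ (fun _ : Fin n => ℝ) k).hasFDerivAt.comp p hg

lemma hasFDerivAt_prolongCoeff (hU : IsOpen U) (hlam : ∀ i, ContDiffOn ℝ ∞ (lam i) U)
    {p : Jet2 n} (hp : p ∈ jetDomain U) :
    ∃ L : Jet2 n →L[ℝ] ℝ, HasFDerivAt (prolongCoeff lam i) L p ∧ ∀ P Q : State n,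
      L (0, 0, 0, P, Q) = P i * (fderiv ℝ (fderiv ℝ (lam i)) p.u p.ux p.ux
            + fderiv ℝ (lam i) p.u p.uxx)
        + p.ux i * (2 * fderiv ℝ (fderiv ℝ (lam i)) p.u P p.ux + fderiv ℝ (lam i) p.u Q)
        + 2 * Q i * fderiv ℝ (lam i) p.u p.ux + 2 * p.uxx i * fderiv ℝ (lam i) p.u P := by
  have h1 := contDiffOn_fderiv hU (hlam i)
  refine ⟨_, ((hasFDerivAt_ux i p).mul
    ((((hasFDerivAt_comp_u hU (contDiffOn_fderiv hU h1) hp).clm_apply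
        Jet2.ux.hasFDerivAt).clm_apply Jet2.ux.hasFDerivAt).add
      ((hasFDerivAt_comp_u hU h1 hp).clm_apply Jet2.uxx.hasFDerivAt))).add
    (((hasFDerivAt_uxx i p).const_mul 2).mul
      ((hasFDerivAt_comp_u hU h1 hp).clm_apply Jet2.ux.hasFDerivAt)), fun P Q => ?_⟩
  have hs := fderiv_fderiv_symm hU (hlam i) hp p.ux P
  simp at hs ⊢
  rw [hs]
  ring

lemma hasFDerivAt_mongeField (hU : IsOpen U) (hlam : ∀ i, ContDiffOn ℝ ∞ (lam i) U)
    {p : Jet2 n} (hp : p ∈ jetDomain U) :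
    ∃ L : Jet2 n →L[ℝ] Jet2 n, HasFDerivAt (mongeField lam i) L p ∧ ∀ P Q : State n,
      L (0, 0, 0, P, Q) = (0, 0, fun l => (lam l p.u - lam i p.u) * P l,
        fun l => fderiv ℝ (lam l) p.u P * p.ux l + totalDx (lam l) p * P l
          + (lam l p.u - lam i p.u) * Q l,
        Pi.single i (P i * (fderiv ℝ (fderiv ℝ (lam i)) p.u p.ux p.ux
            + fderiv ℝ (lam i) p.u p.uxx)
        + p.ux i * (2 * fderiv ℝ (fderiv ℝ (lam i)) p.u P p.ux + fderiv ℝ (lam i) p.u Q)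
        + 2 * Q i * fderiv ℝ (lam i) p.u p.ux + 2 * p.uxx i * fderiv ℝ (lam i) p.u P)) := by
  obtain ⟨C, hC, hC'⟩ := hasFDerivAt_prolongCoeff (i := i) hU hlam hp
  have hl : ∀ k, HasFDerivAt (fun p : Jet2 n => lam k p.u) _ p :=
    fun k => hasFDerivAt_comp_u hU (hlam k) hp
  refine ⟨_, (hl i).neg.prodMk ((hasFDerivAt_const (1 : ℝ) p).prodMk (HasFDerivAt.prodMk
    (hasFDerivAt_pi.2 fun l => ((hl l).sub (hl i)).mul (hasFDerivAt_ux l p))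
    (HasFDerivAt.prodMk
      (hasFDerivAt_pi.2 fun l => ((hasFDerivAt_totalDx hU (hlam l) hp).mul
        (hasFDerivAt_ux l p)).add (((hl l).sub (hl i)).mul (hasFDerivAt_uxx l p)))
      (hasFDerivAt_single i hC)))), fun P Q => ?_⟩
  refine Prod.ext ?_ (Prod.ext ?_ (Prod.ext ?_ (Prod.ext ?_ ?_)))
  · simp
  · simp
  · ext l
    simp
  · ext l
    simp
    ring
  · simp [hC']

lemma hasFDerivAt_firstField (hU : IsOpen U) (hlam : ∀ i, ContDiffOn ℝ ∞ (lam i) U)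
    (hyp : StrictlyHyperbolic U lam) {k : Fin n} (hk : k ≠ i) {p : Jet2 n}
    (hp : p ∈ jetDomain U) :
    ∃ L : Jet2 n →L[ℝ] Jet2 n, HasFDerivAt (firstField lam i k) L p ∧ ∀ v : Jet2 n,
      L v = (0, 0, 0, 0, Pi.single i (p.ux i * fderiv ℝ (coeffA lam i k) p.u v.u
        + v.ux i * coeffA lam i k p.u)) := by
  refine ⟨_, (hasFDerivAt_const (0 : ℝ) p).prodMk ((hasFDerivAt_const (0 : ℝ) p).prodMk
    ((hasFDerivAt_const (0 : State n) p).prodMk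
      ((hasFDerivAt_const (Pi.single k 1 : State n) p).prodMk
        (hasFDerivAt_single i ((hasFDerivAt_ux i p).mul
          (hasFDerivAt_comp_u hU (contDiffOn_coeffA hU hlam hyp hk) hp)))))), fun v => ?_⟩
  refine Prod.ext ?_ (Prod.ext ?_ (Prod.ext ?_ (Prod.ext ?_ ?_)))
  · simp
  · simp
  · simp
  · simp
  · simp only [ContinuousLinearMap.prod_apply, ContinuousLinearMap.comp_apply,
      ContinuousLinearMap.single_apply]
    congr 1
    simp [mul_comm]

lemma hasFDerivAt_secondField (hU : IsOpen U) (hlam : ∀ i, ContDiffOn ℝ ∞ (lam i) U)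
    (hyp : StrictlyHyperbolic U lam) {k : Fin n} (hk : k ≠ i) {p : Jet2 n}
    (hp : p ∈ jetDomain U) :
    ∃ L : Jet2 n →L[ℝ] Jet2 n, HasFDerivAt (secondField lam i k) L p ∧
      ∀ P Q : State n, P i = 0 →
      L (0, 0, 0, P, Q) = (0, 0, 0,
        fun l => pd k (lam l) p.u * P l + (Pi.single k (fderiv ℝ (lam k) p.u P) : State n) l,
        Pi.single i (p.ux i * (2 * fderiv ℝ (fderiv ℝ (lam i)) p.u (Pi.single k 1) P)
          + p.ux i * coeffA lam i k p.u * fderiv ℝ (lam i) p.u P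
          + 2 * Q i * pd k (lam i) p.u
          - p.ux i * fderiv ℝ (coeffA lam i k) p.u
              (fun l => (lam l p.u - lam i p.u) * P l))) := by
  have h1 := contDiffOn_fderiv hU (hlam i)
  have ha := contDiffOn_coeffA hU hlam hyp hk
  have hl : ∀ k, HasFDerivAt (fun p : Jet2 n => lam k p.u) _ p :=
    fun k => hasFDerivAt_comp_u hU (hlam k) hp
  have hpd : ∀ k l, HasFDerivAt (fun p : Jet2 n => pd k (lam l) p.u) _ p :=
    fun k l => hasFDerivAt_comp_u hU (contDiffOn_pd hU (hlam l) k) hp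
  have hua := (hasFDerivAt_ux i p).mul (hasFDerivAt_comp_u hU ha hp)
  have hμ : HasFDerivAt (fun (p : Jet2 n) (l : Fin n) => (lam l p.u - lam i p.u) * p.ux l) _ p :=
    hasFDerivAt_pi.2 fun l => ((hl l).sub (hl i)).mul (hasFDerivAt_ux l p)
  have hC : HasFDerivAt (secondCoeff lam i k) _ p :=
    ((((hasFDerivAt_ux i p).mul (((((hasFDerivAt_comp_u hU (contDiffOn_fderiv hU h1) hp).clm_apply
      (hasFDerivAt_const (Pi.single k 1 : State n) p)).clm_apply
        Jet2.ux.hasFDerivAt).const_mul 2).add (hua.mul (hpd i i)))).add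
      (hua.mul ((hasFDerivAt_comp_u hU h1 hp).clm_apply Jet2.ux.hasFDerivAt))).add
      (((hasFDerivAt_uxx i p).const_mul 2).mul (hpd k i))).sub
      ((hasFDerivAt_ux i p).mul ((hasFDerivAt_comp_u hU (contDiffOn_fderiv hU ha) hp).clm_apply hμ))
  refine ⟨_, (hasFDerivAt_const (0 : ℝ) p).prodMk ((hasFDerivAt_const (0 : ℝ) p).prodMk
    ((hasFDerivAt_single k ((hl k).sub (hl i))).prodMk (HasFDerivAt.prodMk
      (hasFDerivAt_pi.2 fun l => ((hpd k l).mul (hasFDerivAt_ux l p)).add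
        ((ContinuousLinearMap.proj (R := ℝ) (φ := fun _ : Fin n => ℝ) l).hasFDerivAt.comp p
          (hasFDerivAt_single k (hasFDerivAt_totalDx hU (hlam k) hp))))
      (hasFDerivAt_single i hC)))), fun P Q hP => ?_⟩
  refine Prod.ext ?_ (Prod.ext ?_ (Prod.ext ?_ (Prod.ext ?_ ?_)))
  · simp
  · simp
  · simp
  · ext l
    simp
  · simp only [ContinuousLinearMap.prod_apply, ContinuousLinearMap.comp_apply,
      ContinuousLinearMap.single_apply]
    congr 1
    simp [hP]
    ring

/-! ### The invariants of a Monge distribution -/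

section Invariant

variable {W : Set (Jet2 n)} {f : Jet2 n → ℝ}

lemma fderiv_mongeField_eq_zero (hinv : IsRiemannInvariant (mongeDist lam i) W f) {q : Jet2 n}
    (hq : q ∈ W) : fderiv ℝ f q (mongeField lam i q) = 0 :=
  hinv.2 q hq _ (Submodule.subset_span ⟨i, if_pos rfl⟩)

lemma fderiv_euxx_eq_zero (hinv : IsRiemannInvariant (mongeDist lam i) W f) {k : Fin n}
    (hk : k ≠ i) {q : Jet2 n} (hq : q ∈ W) : fderiv ℝ f q (Jet2.euxx k) = 0 :=
  hinv.2 q hq _ (Submodule.subset_span ⟨k, if_neg hk⟩)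

lemma fderiv_firstField_eq_zero (hU : IsOpen U) (hlam : ∀ i, ContDiffOn ℝ ∞ (lam i) U)
    (hyp : StrictlyHyperbolic U lam) (hW : IsOpen W) (hWU : W ⊆ jetDomain U)
    (hinv : IsRiemannInvariant (mongeDist lam i) W f) {k : Fin n} (hk : k ≠ i) {q : Jet2 n}
    (hq : q ∈ W) : fderiv ℝ f q (firstField lam i k q) = 0 := by
  obtain ⟨L, hL, hL'⟩ := hasFDerivAt_mongeField (i := i) hU hlam (hWU hq)
  have h := fderiv_bracket_eq_zero hW hinv.1 (fun q hq => fderiv_euxx_eq_zero hinv hk hq)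
    (fun q hq => fderiv_mongeField_eq_zero hinv hq) hq
    (hasFDerivAt_const (Jet2.euxx k) q) hL
  have hμ : lam k q.u - lam i q.u ≠ 0 := sub_ne_zero.2 (hyp _ (hWU hq) k i hk)
  have heq : L (Jet2.euxx k) - (0 : Jet2 n →L[ℝ] Jet2 n) (mongeField lam i q)
      = (lam k q.u - lam i q.u) • firstField lam i k q := by
    rw [Jet2.euxx, hL', zero_apply, sub_zero]
    have := pd_eq_coeffA_mul hyp hk (hWU hq)
    simp only [pd] at this
    refine Prod.ext ?_ (Prod.ext ?_ (Prod.ext ?_ (Prod.ext ?_ ?_)))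
    · simp [firstField]
    · simp [firstField]
    · ext l
      simp [firstField]
    · ext l
      by_cases hl : l = k
      · subst hl
        simp [firstField]
      · simp [firstField, hl]
    · simp only [firstField, Prod.smul_mk, ← Pi.single_smul, this]
      congr 1
      simp [hk.symm]
      ring
  rw [heq, map_smul, smul_eq_mul] at h
  exact (mul_eq_zero.1 h).resolve_left hμ

lemma fderiv_secondField_eq_zero (hU : IsOpen U) (hlam : ∀ i, ContDiffOn ℝ ∞ (lam i) U)
    (hyp : StrictlyHyperbolic U lam) (hW : IsOpen W) (hWU : W ⊆ jetDomain U)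
    (hinv : IsRiemannInvariant (mongeDist lam i) W f) {k : Fin n} (hk : k ≠ i) {q : Jet2 n}
    (hq : q ∈ W) : fderiv ℝ f q (secondField lam i k q) = 0 := by
  obtain ⟨L, hL, hL'⟩ := hasFDerivAt_mongeField (i := i) hU hlam (hWU hq)
  obtain ⟨M, hM, hM'⟩ := hasFDerivAt_firstField (i := i) hU hlam hyp hk (hWU hq)
  have h := fderiv_bracket_eq_zero hW hinv.1
    (fun q hq => fderiv_firstField_eq_zero hU hlam hyp hW hWU hinv hk hq)
    (fun q hq => fderiv_mongeField_eq_zero hinv hq) hq hM hL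
  have heq : L (firstField lam i k q) - M (mongeField lam i q) = secondField lam i k q := by
    rw [firstField, hL', hM']
    have hcoe : (fderiv ℝ (lam i) q.u) (Pi.single i (q.ux i * coeffA lam i k q.u))
        = q.ux i * coeffA lam i k q.u * pd i (lam i) q.u := by
      have : (Pi.single i (q.ux i * coeffA lam i k q.u) : State n)
          = (q.ux i * coeffA lam i k q.u) • Pi.single i 1 := by
        rw [← Pi.single_smul]; simp
      rw [this, map_smul, pd, smul_eq_mul]
    refine Prod.ext ?_ (Prod.ext ?_ (Prod.ext ?_ (Prod.ext ?_ ?_)))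
    · simp [secondField]
    · simp [secondField]
    · ext l
      by_cases hl : l = k
      · subst hl
        simp [secondField]
      · simp [secondField, hl]
    · ext l
      by_cases hl : l = k
      · subst hl
        simp [secondField, hk, pd]
      · by_cases hl' : l = i
        · subst hl'
          simp [secondField, hl, pd]
        · simp [secondField, hl, hl', pd]
    · simp only [secondField, Prod.mk_sub_mk, ← Pi.single_sub, hcoe]
      congr 1
      simp [hk.symm, mongeField, secondCoeff, pd, totalDx]
      ring
  rwa [heq] at h

/-- The bracket of `firstField lam i j` and `secondField lam i k` is, modulo the first fields, the
multiple of `∂/∂uⁱ_{xx}` by the failure of the semihamiltonian property. -/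
lemma fderiv_euxx_self_mul (hU : IsOpen U) (hlam : ∀ i, ContDiffOn ℝ ∞ (lam i) U)
    (hyp : StrictlyHyperbolic U lam) (hW : IsOpen W) (hWU : W ⊆ jetDomain U)
    (hinv : IsRiemannInvariant (mongeDist lam i) W f) {j k : Fin n} (hj : j ≠ i) (hk : k ≠ i)
    (hjk : j ≠ k) {q : Jet2 n} (hq : q ∈ W) :
    q.ux i * (lam j q.u - lam k q.u) * (pd j (coeffA lam i k) q.u - pd k (coeffA lam i j) q.u)
      * fderiv ℝ f q (Jet2.euxx i) = 0 := by
  obtain ⟨L, hL, hL'⟩ := hasFDerivAt_firstField (i := i) hU hlam hyp hj (hWU hq)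
  obtain ⟨M, hM, hM'⟩ := hasFDerivAt_secondField (i := i) hU hlam hyp hk (hWU hq)
  have h := fderiv_bracket_eq_zero hW hinv.1
    (fun q hq => fderiv_firstField_eq_zero hU hlam hyp hW hWU hinv hj hq)
    (fun q hq => fderiv_secondField_eq_zero hU hlam hyp hW hWU hinv hk hq) hq hL hM
  have hsing : ∀ (g : State n → ℝ) (l : Fin n) (c : ℝ),
      fderiv ℝ g q.u (Pi.single l c) = c * pd l g q.u := by
    intro g l c
    have : (Pi.single l c : State n) = c • Pi.single l 1 := by
      rw [← Pi.single_smul]; simp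
    rw [this, map_smul, pd, smul_eq_mul]
  have hμ : (fun l => (lam l q.u - lam i q.u) * (Pi.single j 1 : State n) l)
      = Pi.single j (lam j q.u - lam i q.u) := by
    ext l
    by_cases hl : l = j
    · subst hl; simp
    · simp [hl]
  have heq : M (firstField lam i j q) - L (secondField lam i k q)
      = pd k (lam j) q.u • firstField lam i j q + pd j (lam k) q.u • firstField lam i k q
        + (-(q.ux i * (lam j q.u - lam k q.u) *
          (pd j (coeffA lam i k) q.u - pd k (coeffA lam i j) q.u))) • Jet2.euxx i := by
    have hd1 := pd_pd_eq hU hlam hyp hj k (hWU hq)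
    have hd2 := pd_pd_eq hU hlam hyp hk j (hWU hq)
    rw [fderiv_fderiv_symm hU (hlam i) (hWU hq)] at hd2
    have e1 := pd_eq_coeffA_mul hyp hj (hWU hq)
    have e2 := pd_eq_coeffA_mul hyp hk (hWU hq)
    rw [firstField, hM' _ _ (by simp [hj.symm]), hL', hμ]
    refine Prod.ext ?_ (Prod.ext ?_ (Prod.ext ?_ (Prod.ext ?_ ?_)))
    · simp [firstField, Jet2.euxx]
    · simp [firstField, Jet2.euxx]
    · simp [firstField, Jet2.euxx]
    · ext l
      by_cases hl : l = j
      · subst hl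
        simp [firstField, Jet2.euxx, hjk]
      · by_cases hl' : l = k
        · subst hl'
          simp [firstField, Jet2.euxx, hl, pd]
        · simp [firstField, Jet2.euxx, hl, hl']
    · simp only [firstField, Jet2.euxx, Prod.smul_mk, Prod.mk_add_mk, Prod.mk_sub_mk,
        ← Pi.single_sub, ← Pi.single_smul, ← Pi.single_add, hsing]
      congr 1
      have hi : (secondField lam i k q).ux i = pd k (lam i) q.u * q.ux i := by
        simp [secondField, hk.symm]
      have hu : (secondField lam i k q).u = Pi.single k (lam k q.u - lam i q.u) := rfl
      rw [hi, hu, hsing, e1, e2]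
      rw [e2] at hd1
      rw [e1] at hd2
      simp only [Pi.single_eq_same, smul_eq_mul]
      linear_combination (q.ux i) * hd1 + (q.ux i) * hd2
  rw [heq, map_add, map_add, map_smul, map_smul,
    fderiv_firstField_eq_zero hU hlam hyp hW hWU hinv hj hq,
    fderiv_firstField_eq_zero hU hlam hyp hW hWU hinv hk hq, map_smul] at h
  simpa using h

/-! ### Where the semihamiltonian property fails -/

lemma eq_sum_coordinates (v : Jet2 n) : v = ((v.1, v.2.1, 0, 0, 0) : Jet2 n)
    + ∑ k, v.u k • Jet2.eu k + ∑ k, v.ux k • Jet2.eux k + ∑ k, v.uxx k • Jet2.euxx k := by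
  refine Prod.ext ?_ (Prod.ext ?_ (Prod.ext ?_ (Prod.ext ?_ ?_)))
  · simp [Prod.fst_sum, Jet2.eu, Jet2.eux, Jet2.euxx]
  · simp [Prod.fst_sum, Prod.snd_sum, Jet2.eu, Jet2.eux, Jet2.euxx]
  all_goals
    ext l
    simp [Prod.fst_sum, Prod.snd_sum, Jet2.eu, Jet2.eux, Jet2.euxx, Pi.single_apply]

/-- Where `∂_j a_{ik} ≠ ∂_k a_{ij}` and `uⁱ_x ≠ 0`, the invariants are of order one at most. -/
lemma fderiv_euxx_eq_zero_of_ne (hU : IsOpen U) (hlam : ∀ i, ContDiffOn ℝ ∞ (lam i) U)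
    (hyp : StrictlyHyperbolic U lam) (hW : IsOpen W) (hWU : W ⊆ jetDomain U)
    (hinv : IsRiemannInvariant (mongeDist lam i) W f) {j k : Fin n} (hj : j ≠ i) (hk : k ≠ i)
    (hjk : j ≠ k) {q : Jet2 n} (hq : q ∈ W) (hux : q.ux i ≠ 0)
    (hne : pd j (coeffA lam i k) q.u ≠ pd k (coeffA lam i j) q.u) (l : Fin n) :
    fderiv ℝ f q (Jet2.euxx l) = 0 := by
  by_cases hl : l = i
  · rw [hl]
    refine (mul_eq_zero.1 (fderiv_euxx_self_mul hU hlam hyp hW hWU hinv hj hk hjk hq)).resolve_left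
      (mul_ne_zero (mul_ne_zero hux ?_) (sub_ne_zero.2 hne))
    exact sub_ne_zero.2 (hyp _ (hWU hq) j k hjk)
  · exact fderiv_euxx_eq_zero hinv hl hq

lemma fderiv_eux_eq_zero (hU : IsOpen U) (hlam : ∀ i, ContDiffOn ℝ ∞ (lam i) U)
    (hyp : StrictlyHyperbolic U lam) (hW : IsOpen W) (hWU : W ⊆ jetDomain U)
    (hinv : IsRiemannInvariant (mongeDist lam i) W f) {q : Jet2 n} (hq : q ∈ W)
    (hxx : ∀ l, fderiv ℝ f q (Jet2.euxx l) = 0) {k : Fin n} (hk : k ≠ i) :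
    fderiv ℝ f q (Jet2.eux k) = 0 := by
  have h := fderiv_firstField_eq_zero hU hlam hyp hW hWU hinv hk hq
  have heq : firstField lam i k q
      = Jet2.eux k + (q.ux i * coeffA lam i k q.u) • Jet2.euxx i := by
    simp [firstField, Jet2.eux, Jet2.euxx, ← Pi.single_smul]
  rwa [heq, map_add, map_smul, hxx, smul_zero, add_zero] at h

variable (lam i) in
/-- The vector field `∂/∂uᵏ + uⁱ_x a_{ik} ∂/∂uⁱ_x`, which for `k ≠ i` annihilates the invariants of
order one at most. -/
def thirdField (k : Fin n) (p : Jet2 n) : Jet2 n :=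
  (0, 0, Pi.single k 1, Pi.single i (p.ux i * coeffA lam i k p.u), 0)

lemma hasFDerivAt_thirdField (hU : IsOpen U) (hlam : ∀ i, ContDiffOn ℝ ∞ (lam i) U)
    (hyp : StrictlyHyperbolic U lam) {k : Fin n} (hk : k ≠ i) {p : Jet2 n}
    (hp : p ∈ jetDomain U) :
    ∃ L : Jet2 n →L[ℝ] Jet2 n, HasFDerivAt (thirdField lam i k) L p ∧ ∀ v : Jet2 n,
      L v = (0, 0, 0, Pi.single i (p.ux i * fderiv ℝ (coeffA lam i k) p.u v.u
        + v.ux i * coeffA lam i k p.u), 0) := by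
  refine ⟨_, (hasFDerivAt_const (0 : ℝ) p).prodMk ((hasFDerivAt_const (0 : ℝ) p).prodMk
    ((hasFDerivAt_const (Pi.single k 1 : State n) p).prodMk
      ((hasFDerivAt_single i ((hasFDerivAt_ux i p).mul
          (hasFDerivAt_comp_u hU (contDiffOn_coeffA hU hlam hyp hk) hp))).prodMk
      (hasFDerivAt_const (0 : State n) p)))), fun v => ?_⟩
  refine Prod.ext ?_ (Prod.ext ?_ (Prod.ext ?_ (Prod.ext ?_ ?_)))
  · simp
  · simp
  · simp
  · simp only [ContinuousLinearMap.prod_apply, ContinuousLinearMap.comp_apply,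
      ContinuousLinearMap.single_apply]
    congr 1
    simp [mul_comm]
  · simp

lemma fderiv_thirdField_eq_zero (hU : IsOpen U) (hlam : ∀ i, ContDiffOn ℝ ∞ (lam i) U)
    (hyp : StrictlyHyperbolic U lam) (hW : IsOpen W) (hWU : W ⊆ jetDomain U)
    (hinv : IsRiemannInvariant (mongeDist lam i) W f) {q : Jet2 n} (hq : q ∈ W)
    (hxx : ∀ l, fderiv ℝ f q (Jet2.euxx l) = 0) {k : Fin n} (hk : k ≠ i) :
    fderiv ℝ f q (thirdField lam i k q) = 0 := by
  have h := fderiv_secondField_eq_zero hU hlam hyp hW hWU hinv hk hq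
  have hμ : lam k q.u - lam i q.u ≠ 0 := sub_ne_zero.2 (hyp _ (hWU hq) k i hk)
  have hpd := pd_eq_coeffA_mul hyp hk (hWU hq)
  have hval : fderiv ℝ f q (secondField lam i k q)
      = (lam k q.u - lam i q.u) * fderiv ℝ f q (thirdField lam i k q) := by
    have hux : ∀ l, l ≠ i → fderiv ℝ f q (Jet2.eux l) = 0 := fun l hl =>
      fderiv_eux_eq_zero hU hlam hyp hW hWU hinv hq hxx hl
    have h00 : ((0, 0, 0, 0, 0) : Jet2 n) = 0 := rfl
    have hsum : ∀ g : Fin n → ℝ, ∑ l, g l * fderiv ℝ f q (Jet2.eux l)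
        = g i * fderiv ℝ f q (Jet2.eux i) := fun g => Finset.sum_eq_single i
      (fun l _ hl => by rw [hux l hl, mul_zero]) (fun h => absurd (Finset.mem_univ i) h)
    rw [eq_sum_coordinates (secondField lam i k q), eq_sum_coordinates (thirdField lam i k q)]
    simp only [map_add, map_sum, map_smul, smul_eq_mul, hxx, hsum]
    simp [secondField, thirdField, h00, hk.symm, Pi.single_apply]
    simp only [Jet2.u_apply] at hpd
    rw [hpd]
    ring
  rw [hval] at h
  exact (mul_eq_zero.1 h).resolve_left hμ

/-- Where the semihamiltonian property fails for the indices `i, j, k`, the invariants are of order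
zero, and depend on `uⁱ` only among the `u`. -/
lemma fderiv_eq_of_ne (hU : IsOpen U) (hlam : ∀ i, ContDiffOn ℝ ∞ (lam i) U)
    (hyp : StrictlyHyperbolic U lam) (hW : IsOpen W) (hWU : W ⊆ jetDomain U)
    (hinv : IsRiemannInvariant (mongeDist lam i) W f) {j k : Fin n} (hj : j ≠ i) (hk : k ≠ i)
    (hjk : j ≠ k) (hux : ∀ q ∈ W, q.ux i ≠ 0)
    (hne : ∀ q ∈ W, pd j (coeffA lam i k) q.u ≠ pd k (coeffA lam i j) q.u)
    {q : Jet2 n} (hq : q ∈ W) :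
    (∀ l, fderiv ℝ f q (Jet2.euxx l) = 0) ∧ (∀ l, fderiv ℝ f q (Jet2.eux l) = 0) ∧
      ∀ l, l ≠ i → fderiv ℝ f q (Jet2.eu l) = 0 := by
  have hxx : ∀ q ∈ W, ∀ l, fderiv ℝ f q (Jet2.euxx l) = 0 := fun q hq l =>
    fderiv_euxx_eq_zero_of_ne hU hlam hyp hW hWU hinv hj hk hjk hq (hux q hq) (hne q hq) l
  have hthird : ∀ l, l ≠ i → ∀ q ∈ W, fderiv ℝ f q (thirdField lam i l q) = 0 := fun l hl q hq =>
    fderiv_thirdField_eq_zero hU hlam hyp hW hWU hinv hq (hxx q hq) hl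
  have hxi : fderiv ℝ f q (Jet2.eux i) = 0 := by
    obtain ⟨L, hL, hL'⟩ := hasFDerivAt_thirdField (i := i) hU hlam hyp hj (hWU hq)
    obtain ⟨M, hM, hM'⟩ := hasFDerivAt_thirdField (i := i) hU hlam hyp hk (hWU hq)
    have h := fderiv_bracket_eq_zero hW hinv.1 (hthird j hj) (hthird k hk) hq hL hM
    have heq : M (thirdField lam i j q) - L (thirdField lam i k q)
        = (q.ux i * (pd j (coeffA lam i k) q.u - pd k (coeffA lam i j) q.u)) • Jet2.eux i := by
      rw [hM', hL']
      simp only [thirdField, Jet2.eux, Prod.smul_mk, Prod.mk_sub_mk, ← Pi.single_sub,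
        ← Pi.single_smul, Jet2.u_apply, Jet2.ux_apply, sub_zero, smul_zero, Pi.single_eq_same,
        smul_eq_mul, mul_one, pd]
      rw [mul_zero]
      congr 5
      ring
    rw [heq, map_smul, smul_eq_mul] at h
    exact (mul_eq_zero.1 h).resolve_left (mul_ne_zero (hux q hq) (sub_ne_zero.2 (hne q hq)))
  refine ⟨hxx q hq, fun l => ?_, fun l hl => ?_⟩
  · by_cases hl : l = i
    · rw [hl, hxi]
    · exact fderiv_eux_eq_zero hU hlam hyp hW hWU hinv hq (hxx q hq) hl
  · have h := hthird l hl q hq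
    have heq : thirdField lam i l q = Jet2.eu l + (q.ux i * coeffA lam i l q.u) • Jet2.eux i := by
      simp [thirdField, Jet2.eu, Jet2.eux, ← Pi.single_smul]
    rwa [heq, map_add, map_smul, hxi, smul_zero, add_zero] at h

/-- Where moreover some `∂_l λⁱ` with `l ≠ i` does not vanish, the invariants depend on `uⁱ`
only: an invariant `f(x, t, uⁱ)` satisfies `f_t = λⁱ f_x`, and differentiating in `uˡ` gives
`∂_l λⁱ f_x = 0`. -/
lemma fderiv_eq_smul_du (hU : IsOpen U) (hlam : ∀ i, ContDiffOn ℝ ∞ (lam i) U)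
    (hyp : StrictlyHyperbolic U lam) (hW : IsOpen W) (hWU : W ⊆ jetDomain U)
    (hinv : IsRiemannInvariant (mongeDist lam i) W f) {j k : Fin n} (hj : j ≠ i) (hk : k ≠ i)
    (hjk : j ≠ k) (hux : ∀ q ∈ W, q.ux i ≠ 0)
    (hne : ∀ q ∈ W, pd j (coeffA lam i k) q.u ≠ pd k (coeffA lam i j) q.u)
    {q : Jet2 n} (hq : q ∈ W) {l : Fin n} (hl : l ≠ i) (hpd : pd l (lam i) q.u ≠ 0) :
    fderiv ℝ f q = fderiv ℝ f q (Jet2.eu i) • Jet2.du i := by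
  have hz : ∀ q ∈ W, _ := fun q hq => fderiv_eq_of_ne hU hlam hyp hW hWU hinv hj hk hjk hux hne
    (q := q) hq
  have hexp : ∀ q ∈ W, ∀ v : Jet2 n, fderiv ℝ f q v
      = fderiv ℝ f q ((v.1, v.2.1, 0, 0, 0) : Jet2 n) + v.u i * fderiv ℝ f q (Jet2.eu i) := by
    intro q hq v
    obtain ⟨h1, h2, h3⟩ := hz q hq
    conv_lhs => rw [eq_sum_coordinates v]
    simp only [map_add, map_sum, map_smul, h1, h2, smul_zero, Finset.sum_const_zero, add_zero]
    rw [Finset.sum_eq_single i (fun b _ hb => by rw [h3 b hb, smul_zero])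
      (fun h => absurd (Finset.mem_univ i) h), smul_eq_mul]
  have hchar : ∀ q ∈ W, fderiv ℝ f q ((-lam i q.u, 1, 0, 0, 0) : Jet2 n) = 0 := by
    intro q hq
    have h := fderiv_mongeField_eq_zero hinv hq
    rw [hexp q hq] at h
    simpa [mongeField] using h
  have hx : fderiv ℝ f q ((1, 0, 0, 0, 0) : Jet2 n) = 0 := by
    have hL : HasFDerivAt (fun q : Jet2 n => ((-lam i q.u, 1, 0, 0, 0) : Jet2 n)) _ q :=
      (hasFDerivAt_comp_u hU (hlam i) (hWU hq)).neg.prodMk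
        (hasFDerivAt_const ((1, 0, 0, 0) : ℝ × State n × State n × State n) q)
    have h := fderiv_bracket_eq_zero hW hinv.1 (fun q hq => (hz q hq).2.2 l hl) hchar hq
      (hasFDerivAt_const (Jet2.eu l) q) hL
    have heq : ∀ w : Jet2 n, ((-(fderiv ℝ (lam i) q.u ∘L Jet2.u)).prod
        (0 : Jet2 n →L[ℝ] ℝ × State n × State n × State n)) (Jet2.eu l)
        - (0 : Jet2 n →L[ℝ] Jet2 n) w = (-pd l (lam i) q.u) • ((1, 0, 0, 0, 0) : Jet2 n) := by
      intro w
      simp [Jet2.eu, pd]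
      rfl
    rw [heq, map_smul, smul_eq_mul] at h
    exact (mul_eq_zero.1 h).resolve_left (neg_ne_zero.2 hpd)
  have ht : fderiv ℝ f q ((0, 1, 0, 0, 0) : Jet2 n) = 0 := by
    have h := hchar q hq
    have heq : ((-lam i q.u, 1, 0, 0, 0) : Jet2 n)
        = (-lam i q.u) • ((1, 0, 0, 0, 0) : Jet2 n) + ((0, 1, 0, 0, 0) : Jet2 n) := by
      simp
    rwa [heq, map_add, map_smul, hx, smul_zero, zero_add] at h
  refine ContinuousLinearMap.ext fun v => ?_
  have heq : ((v.1, v.2.1, 0, 0, 0) : Jet2 n)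
      = v.1 • ((1, 0, 0, 0, 0) : Jet2 n) + v.2.1 • ((0, 1, 0, 0, 0) : Jet2 n) := by
    simp
  rw [hexp q hq, heq, map_add, map_smul, map_smul, hx, ht]
  simp [mul_comm]

end Invariant

/-- On an open set where the semihamiltonian property fails for the indices `i, j, k`, some point
has `∂_l λⁱ ≠ 0` for `l = j` or `l = k`. -/
lemma exists_pd_ne_zero {W : Set (Jet2 n)} (hU : IsOpen U) (hlam : ∀ i, ContDiffOn ℝ ∞ (lam i) U)
    (hyp : StrictlyHyperbolic U lam) (hW : IsOpen W) (hWU : W ⊆ jetDomain U) {j k : Fin n}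
    (hj : j ≠ i) (hk : k ≠ i) {p : Jet2 n} (hp : p ∈ W)
    (hne : pd j (coeffA lam i k) p.u ≠ pd k (coeffA lam i j) p.u) :
    ∃ q ∈ W, ∃ l, l ≠ i ∧ pd l (lam i) q.u ≠ 0 := by
  by_contra! hcon
  have hzero : ∀ l m, l ≠ i → pd m (coeffA lam i l) p.u = 0 := by
    intro l m hl
    have hev : (fun q : Jet2 n => coeffA lam i l q.u) =ᶠ[𝓝 p] fun _ => 0 :=
      Filter.eventually_of_mem (hW.mem_nhds hp) fun q hq => by
        simp only [coeffA, hcon q hq l hl, zero_div]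
    have h1 := (hasFDerivAt_comp_u hU (contDiffOn_coeffA hU hlam hyp hl) (hWU hp)).fderiv
    rw [hev.fderiv_eq, fderiv_fun_const] at h1
    simpa [Jet2.eu, pd] using (DFunLike.congr_fun h1 (Jet2.eu m)).symm
  exact hne (by rw [hzero k j hk, hzero j k hj])

end Hydro
end

open Hydro in
theorem theorem1 (n : ℕ) (U : Set (Hydro.State n)) (hU : IsOpen U)
    (lam : Fin n → Hydro.State n → ℝ) (hlam : ∀ i, ContDiffOn ℝ ∞ (lam i) U)
    (hyp : Hydro.StrictlyHyperbolic U lam) (hD : Hydro.DarbouxIntegrableLT3 U lam) :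
    Hydro.Semihamiltonian U lam := by
  intro u hu i j k hij hik hjk
  by_contra hne
  set D : State n → ℝ := fun v => pd j (coeffA lam i k) v - pd k (coeffA lam i j) v with hDdef
  have hDc : ContinuousOn D U :=
    ((contDiffOn_pd hU (contDiffOn_coeffA hU hlam hyp hik.symm) j).sub
      (contDiffOn_pd hU (contDiffOn_coeffA hU hlam hyp hij.symm) k)).continuousOn
  set O : Set (Jet2 n) := Jet2.u ⁻¹' (U ∩ D ⁻¹' {0}ᶜ) ∩ {q | q.ux i ≠ 0} with hO
  have hOo : IsOpen O := ((hDc.isOpen_inter_preimage hU isOpen_compl_singleton).preimage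
    Jet2.u.continuous).inter (isOpen_ne_fun (Jet2.dux i).continuous continuous_const)
  have hp0 : ((0, 0, u, fun _ => 1, 0) : Jet2 n) ∈ O :=
    ⟨⟨hu, sub_ne_zero.2 hne⟩, one_ne_zero⟩
  obtain ⟨p, hpO, -, W, f, hW, hpW, hf, hli⟩ := mem_closure_iff.1
    (hD _ (isMongeCharacteristic_mongeDist hU hlam i) (show _ ∈ jetDomain U from hu)) O hOo hp0
  have hV : IsOpen (W ∩ O) := hW.inter hOo
  have hVU : W ∩ O ⊆ jetDomain U := fun q hq => hq.2.1.1
  have hneq : ∀ q ∈ W ∩ O, pd j (coeffA lam i k) q.u ≠ pd k (coeffA lam i j) q.u :=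
    fun q hq => sub_ne_zero.1 hq.2.1.2
  obtain ⟨q, hq, l, hl, hpd⟩ := exists_pd_ne_zero hU hlam hyp hV hVU hij.symm hik.symm
    ⟨hpW, hpO⟩ (hneq p ⟨hpW, hpO⟩)
  have hdu : ∀ a, ∃ c : ℝ, fderiv ℝ (f a) q = c • Jet2.du i := fun a =>
    ⟨_, fderiv_eq_smul_du hU hlam hyp hV hVU
      ⟨(hf a).1.mono Set.inter_subset_left, fun q hq => (hf a).2 q hq.1⟩ hij.symm hik.symm hjk
      (fun q hq => hq.2.2) hneq hq hl hpd⟩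
  obtain ⟨c, hc⟩ := hdu 0
  obtain ⟨d, hd⟩ := hdu 1
  have hli' := hli q hq.1
  have hc0 : c ≠ 0 := fun h => hli'.ne_zero 0 (by simp only [hc, h, zero_smul])
  have hrel := Fintype.linearIndependent_iff.1 hli' ![d, -c] (by
    simp [Fin.sum_univ_two, hc, hd, smul_smul, mul_comm]) 1
  exact hc0 (by simpa using hrel)
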